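/- Let $T$ be the infinite rooted binary tree whose vertices are the finite words over $\{0,1\}$, each word $t$ being joined by an edge to the words $t0$ and $t1$. Let $W=\operatorname{Aut}(T)$, with its profinite topology, in which the pointwise stabilizers of the sets of words of length $\le n$ (for $n\ge0$) form a neighbourhood basis of $1$. For $u,v\in W$ let $(u,v)\in W$ be the automorphism $0t\mapsto 0u(t)$, $1t\mapsto 1v(t)$, and let $\sigma\in W$ be the automorphism $0t\leftrightarrow 1t$. Let $r>s\ge 1$ be integers, and let $a_1,\dots,a_r\in W$ be the elements determined by the recursion relations $$a_1=\sigma,\qquad a_{s+1}=(a_s,a_r),\qquad a_i=(a_{i-1},1)\ \text{ for } i\ne 1,s+1 .$$ Let $G\subset W$ be the closure of the subgroup generated by $a_1,\dots,a_r$, and let $N$ be the normalizer of $G$ in $W$. Define $w_1=(1,(a_sa_r)^2)$ and $w_{i+1}=(w_i,w_i)$ for $i\ge1$. Theorem. Assume that $s=1$ and $r\ge3$. Then for every $(k_i)_{i\ge1}\in\prod_{i\ge1}\mathbb F_2$ the infinite product $$\phi(k_1,k_2,\dots)=w_1^{k_1}w_2^{k_2}\cdots=\lim_{n\to\infty}w_1^{k_1}\cdots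 w_n^{k_n}$$ (with $k_i$ represented by $0$ or $1$) converges in $W$ to an element of $N$, the map $\phi\colon\prod_{i\ge1}\mathbb F_2\to N$ is continuous, and composing it with the projection $N\to N/G$ yields an isomorphism of topological groups $$\bar\phi\colon\prod_{i\ge1}\mathbb F_2\ \xrightarrow{\ \sim\ }\ N/G .$$ -/

import Mathlib

open Filter Topology

namespace BinaryTree

/-- The infinite rooted binary tree `T`: its vertices are the finite words over `{0, 1}`
(with `0 = false` and `1 = true`), and every word `t` is joined to `t0` and `t1`.
The root is the empty word. -/
def tree : SimpleGraph (List Bool) where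
  Adj s t := (∃ x, t = s ++ [x]) ∨ (∃ x, s = t ++ [x])
  symm := ⟨fun _ _ h => h.symm⟩
  loopless := ⟨by
    rintro s (⟨x, h⟩ | ⟨x, h⟩) <;> simpa using congrArg List.length h⟩

/-- The automorphism group `W = Aut(T)`; the product is composition, `(u * v) t = u (v t)`. -/
abbrev W : Type := tree ≃g tree

theorem tree_adj_nil {t : List Bool} : tree.Adj [] t ↔ ∃ x, t = [x] := by
  simp [tree]

theorem tree_adj_append (t : List Bool) (x : Bool) : tree.Adj t (t ++ [x]) := Or.inl ⟨x, rfl⟩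

theorem tree_adj_cons (b : Bool) {s t : List Bool} (h : tree.Adj s t) :
    tree.Adj (b :: s) (b :: t) := by
  rcases h with ⟨x, rfl⟩ | ⟨x, rfl⟩
  · exact Or.inl ⟨x, rfl⟩
  · exact Or.inr ⟨x, rfl⟩

/-- Every automorphism of `T` fixes the root, the only vertex with fewer than three neighbours. -/
theorem map_root (w : W) : w [] = [] := by
  obtain ⟨t, ht⟩ := w.surjective []
  rcases List.eq_nil_or_concat t with rfl | ⟨s, x, rfl⟩
  · exact ht
  exfalso
  rw [List.concat_eq_append] at ht
  have key : ∀ y, tree.Adj (s ++ [x]) y → ∃ b, w y = [b] := fun y hy => by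
    have h := (w.map_adj_iff).2 hy
    rw [ht] at h
    exact tree_adj_nil.1 h
  obtain ⟨b₁, h₁⟩ := key s (tree_adj_append s x).symm
  obtain ⟨b₂, h₂⟩ := key _ (tree_adj_append (s ++ [x]) false)
  obtain ⟨b₃, h₃⟩ := key _ (tree_adj_append (s ++ [x]) true)
  have h12 : b₁ ≠ b₂ := by
    rintro rfl
    simpa using congrArg List.length (w.injective (h₁.trans h₂.symm))
  have h13 : b₁ ≠ b₃ := by
    rintro rfl
    simpa using congrArg List.length (w.injective (h₁.trans h₃.symm))
  have h23 : b₂ ≠ b₃ := by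
    rintro rfl
    simpa using w.injective (h₂.trans h₃.symm)
  revert h12 h13 h23
  cases b₁ <;> cases b₂ <;> cases b₃ <;> simp

/-- An automorphism of `T` from a pair of mutually inverse maps that preserve edges. -/
def mkAut (f g : List Bool → List Bool) (hgf : ∀ t, g (f t) = t) (hfg : ∀ t, f (g t) = t)
    (hf : ∀ t x, tree.Adj (f t) (f (t ++ [x]))) (hg : ∀ t x, tree.Adj (g t) (g (t ++ [x]))) :
    W where
  toFun := f
  invFun := g
  left_inv := hgf
  right_inv := hfg
  map_rel_iff' := by
    have aux : ∀ k : List Bool → List Bool, (∀ t x, tree.Adj (k t) (k (t ++ [x]))) →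
        ∀ a b, tree.Adj a b → tree.Adj (k a) (k b) := by
      rintro k hk a b (⟨x, rfl⟩ | ⟨x, rfl⟩)
      · exact hk a x
      · exact (hk b x).symm
    intro a b
    refine ⟨fun h => ?_, aux f hf a b⟩
    have h' := aux g hg _ _ h
    simpa [hgf] using h'

/-- The map underlying `(u, v)`: it sends `0t` to `0u(t)` and `1t` to `1v(t)`. -/
def pairFun (u v : List Bool → List Bool) : List Bool → List Bool
  | [] => []
  | false :: t => false :: u t
  | true :: t => true :: v t

theorem pairFun_adj (u v : W) (t : List Bool) (x : Bool) :
    tree.Adj (pairFun u v t) (pairFun u v (t ++ [x])) := by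
  rcases t with _ | ⟨_ | _, t⟩
  · cases x <;> simp [pairFun, map_root, tree_adj_nil]
  · exact tree_adj_cons _ ((u.map_adj_iff).2 (tree_adj_append t x))
  · exact tree_adj_cons _ ((v.map_adj_iff).2 (tree_adj_append t x))

/-- The element `(u, v)` of `W`, acting by `u` on the subtree below the vertex `0` and by `v` on
the subtree below the vertex `1`. -/
def pair (u v : W) : W :=
  mkAut (pairFun u v) (pairFun (u⁻¹ : W) (v⁻¹ : W))
    (by rintro (_ | ⟨_ | _, t⟩) <;> simp [pairFun, ← RelIso.mul_apply])
    (by rintro (_ | ⟨_ | _, t⟩) <;> simp [pairFun, ← RelIso.mul_apply])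
    (pairFun_adj u v) (pairFun_adj u⁻¹ v⁻¹)

/-- The map underlying `σ`: it interchanges `0t` and `1t`. -/
def swapFun : List Bool → List Bool
  | [] => []
  | b :: t => (!b) :: t

theorem swapFun_adj (t : List Bool) (x : Bool) :
    tree.Adj (swapFun t) (swapFun (t ++ [x])) := by
  rcases t with _ | ⟨b, t⟩
  · simp [swapFun, tree_adj_nil]
  · exact tree_adj_cons _ (tree_adj_append t x)

/-- The element `σ` of `W`, interchanging the two subtrees below the root. -/
def sigma : W :=
  mkAut swapFun swapFun (by rintro (_ | ⟨b, t⟩) <;> simp [swapFun])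
    (by rintro (_ | ⟨b, t⟩) <;> simp [swapFun]) swapFun_adj swapFun_adj

/-- The map underlying the generator `a_i`; see `gen_one`, `gen_succ` and `gen_of_ne` below for the
recursion relations. -/
def genFun (s r : ℕ) : ℕ → List Bool → List Bool
  | _, [] => []
  | i, false :: t => if i = 1 then true :: t else false :: genFun s r (i - 1) t
  | i, true :: t =>
    if i = 1 then false :: t else if i = s + 1 then true :: genFun s r r t else true :: t

theorem genFun_nil (s r i : ℕ) : genFun s r i [] = [] := by
  simp [genFun]

theorem genFun_genFun (s r : ℕ) (t : List Bool) :
    ∀ i, genFun s r i (genFun s r i t) = t := by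
  induction t with
  | nil => intro i; simp [genFun]
  | cons b t ih =>
    intro i
    by_cases h1 : i = 1
    · cases b <;> simp [genFun, h1]
    · by_cases h2 : i = s + 1
      · cases b <;> simp [genFun, h2] <;> grind [genFun]
      · cases b <;> simp [genFun, h1, h2, ih]

theorem genFun_adj (s r : ℕ) (t : List Bool) (x : Bool) :
    ∀ i, tree.Adj (genFun s r i t) (genFun s r i (t ++ [x])) := by
  induction t with
  | nil =>
    intro i
    by_cases h1 : i = 1
    · cases x <;> simp [genFun, h1, tree_adj_nil]
    · by_cases h2 : i = s + 1 <;> cases x <;> simp [genFun, h1, tree_adj_nil]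
  | cons b t ih =>
    intro i
    by_cases h1 : i = 1
    · cases b <;> simpa [genFun, h1] using tree_adj_cons _ (tree_adj_append t x)
    · cases b
      · simpa [genFun, h1] using tree_adj_cons false (ih (i - 1))
      · by_cases h2 : i = s + 1
        · have := tree_adj_cons true (ih r)
          simp only [List.cons_append, genFun, h1, if_false, if_pos h2]
          exact this
        · simpa [genFun, h1, h2] using tree_adj_cons true (tree_adj_append t x)

/-- The generators `a_i`, `1 ≤ i ≤ r`, for given integers `r > s ≥ 1`. They are the unique
solution in `W` of the recursion relations `a_1 = σ`, `a_{s+1} = (a_s, a_r)`, and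
`a_i = (a_{i-1}, 1)` for `i ≠ 1, s + 1`. -/
def gen (s r i : ℕ) : W :=
  mkAut (genFun s r i) (genFun s r i) (fun t => genFun_genFun s r t i)
    (fun t => genFun_genFun s r t i) (fun t x => genFun_adj s r t x i)
    (fun t x => genFun_adj s r t x i)

theorem gen_one (s r : ℕ) : gen s r 1 = sigma := by
  ext1 t
  change genFun s r 1 t = swapFun t
  rcases t with _ | ⟨_ | _, t⟩ <;> simp [genFun, swapFun]

theorem gen_succ (s r : ℕ) (hs : 1 ≤ s) :
    gen s r (s + 1) = pair (gen s r s) (gen s r r) := by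
  ext1 t
  change genFun s r (s + 1) t = pairFun (genFun s r s) (genFun s r r) t
  have : s ≠ 0 := by omega
  rcases t with _ | ⟨_ | _, t⟩ <;> simp [genFun, pairFun, this]

theorem gen_of_ne (s r i : ℕ) (h1 : i ≠ 1) (h2 : i ≠ s + 1) :
    gen s r i = pair (gen s r (i - 1)) 1 := by
  ext1 t
  change genFun s r i t = pairFun (genFun s r (i - 1)) (1 : W) t
  rcases t with _ | ⟨_ | _, t⟩ <;> simp [genFun, pairFun, h1, h2]

/-- The profinite topology on `W = lim W_n`: the topology of pointwise convergence on the
(discrete) set of vertices. -/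
instance : TopologicalSpace W :=
  TopologicalSpace.induced (fun (w : W) (t : List Bool) => w t)
    (@Pi.topologicalSpace _ _ fun _ => ⊥)

theorem isOpen_fiber (t u : List Bool) : IsOpen {w : W | w t = u} := by
  let : TopologicalSpace (List Bool) := ⊥
  have : DiscreteTopology (List Bool) := ⟨rfl⟩
  have h : Continuous fun w : W => w t :=
    (continuous_apply t).comp (continuous_induced_dom (f := fun (w : W) (t : List Bool) => w t))
  exact (isOpen_discrete {u}).preimage h

theorem continuous_of_fiber {X : Type*} [TopologicalSpace X] {f : X → W}
    (h : ∀ t u, IsOpen {x | f x t = u}) : Continuous f := by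
  let : TopologicalSpace (List Bool) := ⊥
  have : DiscreteTopology (List Bool) := ⟨rfl⟩
  refine continuous_induced_rng.2 (continuous_pi fun t => ?_)
  exact continuous_discrete_rng.2 fun u => h t u

instance : IsTopologicalGroup W where
  continuous_mul := continuous_of_fiber fun t u => by
    have : {p : W × W | (p.1 * p.2) t = u} =
        ⋃ v, Prod.fst ⁻¹' {w : W | w v = u} ∩ Prod.snd ⁻¹' {w : W | w t = v} := by
      ext p
      simp [RelIso.mul_apply]
    change IsOpen {p : W × W | (p.1 * p.2) t = u}
    rw [this]
    exact isOpen_iUnion fun v => ((isOpen_fiber v u).preimage continuous_fst).inter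
      ((isOpen_fiber t v).preimage continuous_snd)
  continuous_inv := continuous_of_fiber fun t u => by
    have : {w : W | w⁻¹ t = u} = {w : W | w u = t} := by
      ext w
      exact ⟨fun h => by rw [← h]; exact RelIso.apply_symm_apply w t,
        fun h => by rw [← h]; exact RelIso.symm_apply_apply w u⟩
    change IsOpen {w : W | w⁻¹ t = u}
    rw [this]
    exact isOpen_fiber u t

/-- The kernels of the restriction maps `W → W_n` form a neighbourhood basis of `1` in `W`. -/
theorem hasBasis_nhds_one :
    (𝓝 (1 : W)).HasBasis (fun _ : ℕ => True) fun n => {w : W | ∀ t, t.length ≤ n → w t = t} := by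
  let : TopologicalSpace (List Bool) := ⊥
  have : DiscreteTopology (List Bool) := ⟨rfl⟩
  refine ⟨fun S => ⟨fun hS => ?_, ?_⟩⟩
  · rw [nhds_induced, Filter.mem_comap] at hS
    obtain ⟨V, hV, hVS⟩ := hS
    rw [nhds_pi, Filter.mem_pi] at hV
    obtain ⟨I, hI, U, hU, hIU⟩ := hV
    obtain ⟨n, hn⟩ := (hI.image List.length).bddAbove
    refine ⟨n, trivial, fun w hw => hVS (hIU fun t ht => ?_)⟩
    change w t ∈ U t
    rw [hw t (hn ⟨t, ht, rfl⟩)]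
    exact mem_of_mem_nhds (hU t)
  · rintro ⟨n, -, hn⟩
    refine mem_of_superset ?_ hn
    have hfin : {t : List Bool | t.length ≤ n}.Finite := List.finite_length_le Bool n
    have : {w : W | ∀ t, t.length ≤ n → w t = t} =
        ⋂ t ∈ {t : List Bool | t.length ≤ n}, {w : W | w t = t} := by
      ext w
      simp
    rw [this]
    exact (hfin.isOpen_biInter fun t _ => isOpen_fiber t t).mem_nhds (by simp)

/-- The closed subgroup `G` of `W` topologically generated by `a_1, …, a_r`. -/
def G (s r : ℕ) : Subgroup W :=
  (Subgroup.closure {g | ∃ i, 1 ≤ i ∧ i ≤ r ∧ g = gen s r i}).topologicalClosure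

/-- The normalizer `N` of `G` in `W`. -/
def N (s r : ℕ) : Subgroup W := Subgroup.normalizer (G s r : Set W)

/-- `G` regarded as a subgroup of its normalizer `N`. -/
def GinN (s r : ℕ) : Subgroup (N s r) := (G s r).subgroupOf (N s r)

instance (s r : ℕ) : (GinN s r).Normal :=
  Subgroup.normal_in_normalizer (H := G s r)

/-- The sequence `w_1 = (1, (a_s a_r)^2)`, `w_{i+1} = (w_i, w_i)`, indexed from zero, so that
`wElt s r i` is `w_{i+1}`. -/
def wElt (s r : ℕ) : ℕ → W
  | 0 => pair 1 ((gen s r s * gen s r r) ^ 2)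
  | i + 1 => pair (wElt s r i) (wElt s r i)

/-- The ordered partial product `w_1^{k_1} w_2^{k_2} ⋯ w_n^{k_n}`, where `k i` is `k_{i+1}`. -/
def partialProd (s r : ℕ) (k : ℕ → ZMod 2) (n : ℕ) : W :=
  ((List.range n).map fun i => wElt s r i ^ (k i).val).prod

end BinaryTree

namespace BinaryTree

/-! The proof rests on a split quotient of `G` isomorphic to the dihedral group D of order 8. The
map `octic (r - 2)` records the root swap and one parity of each section. It sends a_1 and a_r to
generating reflections and kills the other generators; `lift` splits it, with image ⟨a_1, a_r⟩.
Since a_2 = (a_1, a_r), `G` consists exactly of the elements whose sections lie in `G` and have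
D-images exchanged by the outer automorphism `tau` (`G_eq_sectionSubgroup`).

This makes N recursive. Modulo `G` every element of N has trivial D-image, so it suffices to treat
`centralN`; it acts trivially on D by conjugation, so `diag` preserves it. If (u, v) lies in N and u
has trivial D-image, then v u⁻¹ lies in `G` and has D-image in the centre {1, z}, where z is the
image of (a_1 a_r)². This single bit is realized by w_1, giving w = g w_1^c diag(u) with u again in
`centralN` (`exists_decomposition`). Iteration gives surjectivity, since the n-fold diagonal tends
to 1.

Conversely, if w_1^c diag(v) lies in `G` with v in `centralN`, then c = 0 because `tau` fixes the
centre, and v lies in `G` (`of_infProd_mem_G`); this gives injectivity. Multiplicativity modulo `G`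
holds because w_1 commutes with diagonals modulo `centralG`. -/

/-! ### Sections and the wreath recursion on `W`. -/

theorem exists_map_append_singleton (w : W) (t : List Bool) :
    ∀ x, ∃ y, w (t ++ [x]) = w t ++ [y] := by
  induction t using List.reverseRecOn with
  | nil =>
    intro x
    have h := w.map_adj_iff.2 (tree_adj_append [] x)
    rw [map_root, tree_adj_nil] at h
    simpa [map_root] using h
  | append_singleton t z ih =>
    intro x
    rcases w.map_adj_iff.2 (tree_adj_append (t ++ [z]) x) with ⟨y, hy⟩ | ⟨y, hy⟩
    · exact ⟨y, hy⟩
    -- Otherwise the image is the parent of `w (t ++ [z])`, which is already `w t`; injectivity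
    -- forbids this.
    · obtain ⟨y', hy'⟩ := ih z
      have h := (List.append_inj' (hy'.symm.trans hy) rfl).1
      have := congrArg List.length (w.injective h)
      simp at this

@[simp]
theorem length_map (w : W) (t : List Bool) : (w t).length = t.length := by
  induction t using List.reverseRecOn with
  | nil => simp [map_root]
  | append_singleton t z ih =>
    obtain ⟨y, hy⟩ := exists_map_append_singleton w t z
    simp [hy, ih]

/-- Whether `w` interchanges the two vertices of length one. -/
def swaps (w : W) : Bool := (w [false]).headI

theorem map_singleton (w : W) (b : Bool) : w [b] = [b ^^ swaps w] := by
  obtain ⟨y, hy⟩ := exists_map_append_singleton w [] false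
  obtain ⟨y', hy'⟩ := exists_map_append_singleton w [] true
  simp only [map_root, List.nil_append] at hy hy'
  have hs : swaps w = y := by simp [swaps, hy]
  have hne : y ≠ y' := by
    rintro rfl
    simpa using w.injective (hy.trans hy'.symm)
  cases b
  · simp [hy, hs]
  · rw [hy', hs]
    revert hne
    cases y <;> cases y' <;> simp

theorem map_cons_eq (w : W) (b : Bool) (t : List Bool) :
    w (b :: t) = (b ^^ swaps w) :: (w (b :: t)).tail := by
  induction t using List.reverseRecOn with
  | nil => simp [map_singleton]
  | append_singleton t z ih =>
    obtain ⟨y, hy⟩ := exists_map_append_singleton w (b :: t) z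
    rw [← List.cons_append, hy, ih]
    simp

theorem inv_apply_apply (w : W) (t : List Bool) : w⁻¹ (w t) = t := RelIso.symm_apply_apply w t

theorem apply_inv_apply (w : W) (t : List Bool) : w (w⁻¹ t) = t := RelIso.apply_symm_apply w t

theorem inv_apply_eq {w : W} {s t : List Bool} : w⁻¹ s = t ↔ s = w t :=
  ⟨fun h => by rw [← h, apply_inv_apply], fun h => by rw [h, inv_apply_apply]⟩

theorem tail_map_adj (w : W) (b : Bool) (t : List Bool) (x : Bool) :
    tree.Adj (w (b :: t)).tail (w (b :: (t ++ [x]))).tail := by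
  obtain ⟨y, hy⟩ := exists_map_append_singleton w (b :: t) x
  rw [← List.cons_append, hy, map_cons_eq]
  exact tree_adj_append _ y

/-- The section of `w` at the vertex `b` of length one. -/
def sec (w : W) (b : Bool) : W :=
  mkAut (fun t => (w (b :: t)).tail) (fun t => (w⁻¹ ((b ^^ swaps w) :: t)).tail)
    (fun t => by rw [← map_cons_eq, inv_apply_apply, List.tail_cons])
    (fun t => by
      obtain ⟨c, l, h⟩ : ∃ c l, w⁻¹ ((b ^^ swaps w) :: t) = c :: l := ⟨_, _, map_cons_eq _ _ _⟩
      rw [h, List.tail_cons]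
      have h' := inv_apply_eq.1 h
      rw [map_cons_eq] at h'
      obtain rfl : b = c := by
        have := (List.cons.inj h').1
        revert this
        cases b <;> cases c <;> cases swaps w <;> simp
      exact (List.cons.inj h').2.symm)
    (tail_map_adj w b) (tail_map_adj w⁻¹ _)

theorem map_cons (w : W) (b : Bool) (t : List Bool) :
    w (b :: t) = (b ^^ swaps w) :: sec w b t := map_cons_eq w b t

theorem ext_of_sec {u v : W} (h : swaps u = swaps v) (h' : ∀ b, sec u b = sec v b) : u = v := by
  ext1 t
  rcases t with _ | ⟨b, t⟩
  · simp [map_root]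
  · simp [map_cons, h, h']

@[simp]
theorem swaps_mul (u v : W) : swaps (u * v) = (swaps v ^^ swaps u) := by
  have h := map_singleton (u * v) false
  rw [RelIso.mul_apply, map_singleton, map_singleton] at h
  simpa using h.symm

@[simp]
theorem sec_mul (u v : W) (b : Bool) : sec (u * v) b = sec u (b ^^ swaps v) * sec v b := by
  ext1 t
  have h := map_cons (u * v) b t
  rw [RelIso.mul_apply, map_cons, map_cons] at h
  exact (List.cons.inj h).2.symm

@[simp]
theorem swaps_one : swaps 1 = false := rfl

@[simp]
theorem sec_one (b : Bool) : sec 1 b = 1 := rfl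

@[simp]
theorem swaps_inv (u : W) : swaps u⁻¹ = swaps u := by
  have h := swaps_mul u u⁻¹
  rw [mul_inv_cancel, swaps_one] at h
  revert h
  cases swaps u <;> cases swaps u⁻¹ <;> simp

@[simp]
theorem sec_inv (u : W) (b : Bool) : sec u⁻¹ b = (sec u (b ^^ swaps u))⁻¹ := by
  have h := sec_mul u u⁻¹ b
  rw [mul_inv_cancel, sec_one, swaps_inv] at h
  exact (inv_eq_of_mul_eq_one_right h.symm).symm

@[simp]
theorem swaps_pair (u v : W) : swaps (pair u v) = false := by
  simp [swaps, pair, mkAut, pairFun]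

@[simp]
theorem sec_pair_false (u v : W) : sec (pair u v) false = u := rfl

@[simp]
theorem sec_pair_true (u v : W) : sec (pair u v) true = v := rfl

@[simp]
theorem swaps_sigma : swaps sigma = true := rfl

@[simp]
theorem sec_sigma (b : Bool) : sec sigma b = 1 := rfl

theorem eq_pair_of_swaps {w : W} (h : swaps w = false) : w = pair (sec w false) (sec w true) :=
  ext_of_sec (by simp [h]) (by rintro (_ | _) <;> simp)

theorem sigma_mul_self : sigma * sigma = 1 := ext_of_sec (by simp) (by simp)

theorem pair_mul (u v u' v' : W) : pair u v * pair u' v' = pair (u * u') (v * v') :=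
  ext_of_sec (by simp) (by rintro (_ | _) <;> simp)

theorem pair_one_one : pair 1 1 = 1 := ext_of_sec (by simp) (by rintro (_ | _) <;> simp)

/-- The diagonal embedding `u ↦ (u, u)`. -/
def diag : W →* W where
  toFun u := pair u u
  map_one' := pair_one_one
  map_mul' u v := (pair_mul u u v v).symm

@[simp]
theorem swaps_diag (u : W) : swaps (diag u) = false := swaps_pair u u

@[simp]
theorem sec_diag (u : W) (b : Bool) : sec (diag u) b = u := by cases b <;> rfl

/-! Continuity. -/

theorem continuous_swaps : Continuous swaps := by
  refine continuous_discrete_rng.2 fun b => ?_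
  have : swaps ⁻¹' {b} = {w : W | w [false] = [b]} := by
    ext w
    simp [map_singleton]
  rw [this]
  exact isOpen_fiber _ _

theorem continuous_sec (b : Bool) : Continuous fun w => sec w b :=
  continuous_of_fiber fun t u => by
    have : {w : W | sec w b t = u} = ⋃ c, {w : W | w (b :: t) = c :: u} := by
      ext w
      simp [map_cons]
    rw [this]
    exact isOpen_iUnion fun c => isOpen_fiber _ _

theorem continuous_pair_left (v : W) : Continuous fun u => pair u v :=
  continuous_of_fiber fun t u => by
    rcases t with _ | ⟨b, t⟩
    · simp [map_root]
    · rcases b with _ | _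
      · have : {x : W | (pair x v) (false :: t) = u} = ⋃ l, {x : W | x t = l ∧ false :: l = u} := by
          ext x
          simp [map_cons]
        rw [this]
        refine isOpen_iUnion fun l => ?_
        by_cases h : false :: l = u
        · simpa [h] using isOpen_fiber t l
        · simp [h]
      · simp [map_cons]

theorem tendsto_of_eventually_eq {f : ℕ → W} {w : W} (h : ∀ t, ∀ᶠ n in atTop, f n t = w t) :
    Tendsto f atTop (𝓝 w) := by
  let : TopologicalSpace (List Bool) := ⊥
  have : DiscreteTopology (List Bool) := ⟨rfl⟩
  rw [nhds_induced, tendsto_comap_iff, tendsto_pi_nhds]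
  intro t
  refine tendsto_nhds_of_eventually_eq ?_
  simpa using h t

/-- A sequence in `W` that is stationary on every level has a limit. -/
theorem exists_limit {f : ℕ → W} (h : ∀ n t, t.length ≤ n → f (n + 1) t = f n t) :
    ∃ w : W, ∀ n t, t.length ≤ n → f n t = w t := by
  have h1 : ∀ n t, t.length ≤ n → f n t = f t.length t := by
    intro n t hn
    induction n, hn using Nat.le_induction with
    | base => rfl
    | succ n hn ih => rw [h n t hn, ih]
  -- Levels are preserved, so the inverses are stationary too, and the limit is invertible.
  have h2 : ∀ n t, t.length ≤ n → (f n)⁻¹ t = (f t.length)⁻¹ t := by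
    intro n t hn
    have := h1 n ((f t.length)⁻¹ t) (by simpa using hn)
    rw [length_map, apply_inv_apply] at this
    exact inv_apply_eq.2 this.symm
  have adj : ∀ (g : W) (t : List Bool) (x : Bool), tree.Adj (g t) (g (t ++ [x])) :=
    fun g t x => g.map_adj_iff.2 (tree_adj_append t x)
  refine ⟨mkAut (fun t => f t.length t) (fun t => (f t.length)⁻¹ t) ?_ ?_ ?_ ?_, h1⟩
  · intro t
    rw [length_map, inv_apply_apply]
  · intro t
    rw [length_map, apply_inv_apply]
  · intro t x
    rw [← h1 (t ++ [x]).length t (by simp)]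
    exact adj _ _ _
  · intro t x
    rw [← h2 (t ++ [x]).length t (by simp)]
    exact adj _ _ _

/-! ### The dihedral group D and its outer automorphism. -/

/-- The dihedral group of order eight, realized as the wreath product of two groups of order two:
`e` tells whether the two coordinates `x`, `y` are interchanged. -/
structure Octic where
  e : Bool
  x : Bool
  y : Bool
deriving DecidableEq, Fintype

namespace Octic

instance : Mul Octic where
  mul a b := ⟨b.e ^^ a.e, (if b.e then a.y else a.x) ^^ b.x, (if b.e then a.x else a.y) ^^ b.y⟩

instance : One Octic := ⟨⟨false, false, false⟩⟩

instance : Inv Octic where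
  inv a := ⟨a.e, if a.e then a.y else a.x, if a.e then a.x else a.y⟩

theorem mul_def (a b : Octic) : a * b =
    ⟨b.e ^^ a.e, (if b.e then a.y else a.x) ^^ b.x, (if b.e then a.x else a.y) ^^ b.y⟩ := rfl

theorem one_def : (1 : Octic) = ⟨false, false, false⟩ := rfl

instance : Group Octic :=
  Group.ofLeftAxioms
    (by
      rintro ⟨a, b, c⟩ ⟨a', b', c'⟩ ⟨a'', b'', c''⟩
      simp only [mul_def]
      cases a' <;> cases a'' <;> simp)
    (by decide) (by decide)

instance : TopologicalSpace Octic := ⊥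

instance : DiscreteTopology Octic := ⟨rfl⟩

/-- The nontrivial central element. -/
def z : Octic := ⟨false, true, true⟩

/-- The outer automorphism that interchanges the reflections `⟨true, false, false⟩` and
`⟨false, true, false⟩`. -/
def tau : Octic →* Octic where
  toFun a := ⟨a.x ^^ a.y, if a.e then !a.x else a.y, if a.e then a.x else a.y⟩
  map_one' := by decide
  map_mul' := by decide

@[simp]
theorem tau_tau : ∀ a, tau (tau a) = a := by decide

theorem mem_center : ∀ a, a ∈ Subgroup.center Octic ↔ a = 1 ∨ a = z := by
  simp only [Subgroup.mem_center_iff]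
  decide

theorem tau_z : tau z = z := by decide

theorem tau_of_mem_center {a : Octic} (h : a ∈ Subgroup.center Octic) : tau a = a := by
  rcases (mem_center a).1 h with rfl | rfl
  · exact map_one tau
  · exact tau_z

theorem closure_reflections :
    Subgroup.closure {(⟨true, false, false⟩ : Octic), ⟨false, true, false⟩} = ⊤ := by
  refine eq_top_iff.2 fun a _ => ?_
  set S : Subgroup Octic := Subgroup.closure {⟨true, false, false⟩, ⟨false, true, false⟩}
  have hα : (⟨true, false, false⟩ : Octic) ∈ S := Subgroup.subset_closure (by simp)
  have hβ : (⟨false, true, false⟩ : Octic) ∈ S := Subgroup.subset_closure (by simp)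
  -- Conjugating the flip of `x` by the interchange gives the flip of `y`.
  have key : ∀ a : Octic, a = ⟨true, false, false⟩ ^ a.e.toNat * ⟨false, true, false⟩ ^ a.x.toNat *
      (⟨true, false, false⟩ * ⟨false, true, false⟩ * ⟨true, false, false⟩) ^ a.y.toNat := by
    rintro ⟨_ | _, _ | _, _ | _⟩ <;> simp [one_def, mul_def]
  rw [key a]
  exact mul_mem (mul_mem (pow_mem hα _) (pow_mem hβ _))
    (pow_mem (mul_mem (mul_mem hα hβ) hα) _)

end Octic

/-! ### Level parities and the homomorphisms from `W` to D. -/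

/-- The parity of the permutation that `w` induces on the words of length `n + 1`. -/
def par : ℕ → W → Bool
  | 0, w => swaps w
  | n + 1, w => par n (sec w false) ^^ par n (sec w true)

@[simp]
-- A swap by `v` only permutes the two sections of `u`, and the sum of their parities is symmetric.
theorem par_mul (n : ℕ) : ∀ u v, par n (u * v) = (par n u ^^ par n v) := by
  induction n with
  | zero => intro u v; simp [par, Bool.xor_comm]
  | succ n ih =>
    intro u v
    simp only [par, sec_mul, ih]
    cases swaps v <;> simp <;> grind

@[simp]
theorem par_one (n : ℕ) : par n 1 = false := by
  have := par_mul n 1 1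
  rw [mul_one] at this
  simpa using this

theorem continuous_par (n : ℕ) : Continuous (par n) := by
  induction n with
  | zero => exact continuous_swaps
  | succ n ih =>
    exact (continuous_of_discreteTopology (f := fun p : Bool × Bool => p.1 ^^ p.2)).comp
      ((ih.comp (continuous_sec false)).prodMk (ih.comp (continuous_sec true)))

/-- The action of `w` on its sections by parity on the words of length `n + 2`, as an element of
the wreath product `Octic`. -/
def octic (n : ℕ) : W →* Octic where
  toFun w := ⟨swaps w, par n (sec w false), par n (sec w true)⟩
  map_one' := by simp [Octic.one_def]
  map_mul' u v := by
    simp only [Octic.mul_def, swaps_mul, sec_mul, par_mul]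
    cases swaps v <;> simp

theorem octic_apply (n : ℕ) (w : W) :
    octic n w = ⟨swaps w, par n (sec w false), par n (sec w true)⟩ := rfl

theorem continuous_octic (n : ℕ) : Continuous (octic n) :=
  (continuous_of_discreteTopology (f := fun p : Bool × Bool × Bool => Octic.mk p.1 p.2.1 p.2.2)).comp
    (continuous_swaps.prodMk (((continuous_par n).comp (continuous_sec false)).prodMk
      ((continuous_par n).comp (continuous_sec true))))

theorem octic_diag_mem_center (n : ℕ) (u : W) : octic n (diag u) ∈ Subgroup.center Octic := by
  rw [Octic.mem_center, octic_apply]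
  simp only [swaps_diag, sec_diag]
  cases par n u
  · exact Or.inl rfl
  · exact Or.inr rfl

theorem gen_mul_self (s r i : ℕ) : gen s r i * gen s r i = 1 := by
  ext1 t
  exact genFun_genFun s r t i

theorem isClosed_G (s r : ℕ) : IsClosed (G s r : Set W) := Subgroup.isClosed_topologicalClosure _

theorem gen_mem_G {s r i : ℕ} (h1 : 1 ≤ i) (h2 : i ≤ r) : gen s r i ∈ G s r :=
  Subgroup.le_topologicalClosure _ (Subgroup.subset_closure ⟨i, h1, h2, rfl⟩)

theorem G_le_of_isClosed {s r : ℕ} {H : Subgroup W} (hH : IsClosed (H : Set W))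
    (h : ∀ i, 1 ≤ i → i ≤ r → gen s r i ∈ H) : G s r ≤ H := by
  refine Subgroup.topologicalClosure_minimal _ ?_ hH
  rw [Subgroup.closure_le]
  rintro _ ⟨i, h1, h2, rfl⟩
  exact h i h1 h2

/-! ### The quotient D of `G` and the self-similar description of `G`. -/

section

variable {r : ℕ}

/-- The recursion lowers the level and the index together. The bound on `n` keeps the second section
a_r of a_2 from contributing. -/
theorem par_gen (n : ℕ) : ∀ i, n + 1 < r → 1 ≤ i → i ≤ r →
    par n (gen 1 r i) = decide (i = n + 1) := by
  induction n with
  | zero =>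
    intro i hn h1 h2
    rcases eq_or_ne i 1 with rfl | hi
    · simp [par, gen_one]
    rcases eq_or_ne i 2 with rfl | hi'
    · simp [par, gen_succ 1 r le_rfl]
    · simp [par, gen_of_ne 1 r i hi hi', hi]
  | succ n ih =>
    intro i hn h1 h2
    rcases eq_or_ne i 1 with rfl | hi
    · simp [par, gen_one]
    rcases eq_or_ne i 2 with rfl | hi'
    · rw [gen_succ 1 r le_rfl, par, sec_pair_false, sec_pair_true, ih 1 (by omega) (by omega) (by omega),
        ih r (by omega) (by omega) (by omega), decide_eq_false (p := r = n + 1) (by omega)]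
      simp
    · rw [gen_of_ne 1 r i hi hi', par, sec_pair_false, sec_pair_true,
        ih (i - 1) (by omega) (by omega) (by omega), par_one, Bool.xor_false]
      exact decide_eq_decide.2 (by omega)

theorem gen_last (hr : 3 ≤ r) : gen 1 r r = pair (gen 1 r (r - 1)) 1 :=
  gen_of_ne 1 r r (by omega) (by omega)

theorem octic_gen_one : octic (r - 2) (gen 1 r 1) = ⟨true, false, false⟩ := by
  simp [octic_apply, gen_one]

theorem octic_gen_last (hr : 3 ≤ r) : octic (r - 2) (gen 1 r r) = ⟨false, true, false⟩ := by
  simp only [octic_apply, gen_last hr, swaps_pair, sec_pair_false, sec_pair_true, par_one]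
  rw [par_gen _ _ (by omega) (by omega) (by omega), decide_eq_true (by omega)]

theorem octic_gen_of_ne (hr : 3 ≤ r) {i : ℕ} (h1 : 1 < i) (h2 : i < r) :
    octic (r - 2) (gen 1 r i) = 1 := by
  rw [octic_apply, Octic.one_def]
  rcases eq_or_ne i 2 with rfl | hi
  -- At this level only a_{r-1} is odd; as r ≥ 3 it differs from both sections a_1 and a_r.
  · simp only [gen_succ 1 r le_rfl, swaps_pair, sec_pair_false, sec_pair_true]
    rw [par_gen _ _ (by omega) (by omega) (by omega), par_gen _ _ (by omega) (by omega) (by omega),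
      decide_eq_false (by omega), decide_eq_false (by omega)]
  · simp only [gen_of_ne 1 r i (by omega) hi, swaps_pair, sec_pair_false, sec_pair_true, par_one]
    rw [par_gen _ _ (by omega) (by omega) (by omega), decide_eq_false (by omega)]

/-- The elements of `W` whose sections lie in `G` and are related by the outer automorphism of
the dihedral group. -/
def sectionSubgroup (r : ℕ) : Subgroup W where
  carrier := {w | (∀ b, sec w b ∈ G 1 r) ∧
    ∀ b, octic (r - 2) (sec w !b) = Octic.tau (octic (r - 2) (sec w b))}
  one_mem' := ⟨fun _ => one_mem _, fun _ => by simp⟩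
  mul_mem' := by
    rintro u v ⟨hu, hu'⟩ ⟨hv, hv'⟩
    refine ⟨fun b => ?_, fun b => ?_⟩
    · rw [sec_mul]
      exact mul_mem (hu _) (hv _)
    · rw [sec_mul, sec_mul, map_mul, map_mul, map_mul, ← hv', ← hu', Bool.not_xor]
  inv_mem' := by
    rintro u ⟨hu, hu'⟩
    refine ⟨fun b => ?_, fun b => ?_⟩
    · rw [sec_inv]
      exact inv_mem (hu _)
    · rw [sec_inv, sec_inv, map_inv, map_inv, map_inv, ← hu', Bool.not_xor]

theorem isClosed_sectionSubgroup : IsClosed (sectionSubgroup r : Set W) := by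
  have h1 : IsClosed {w : W | ∀ b, sec w b ∈ G 1 r} := by
    rw [Set.ofPred_forall]
    exact isClosed_iInter fun b => (isClosed_G 1 r).preimage (continuous_sec b)
  have h2 : IsClosed {w : W | ∀ b, octic (r - 2) (sec w !b) =
      Octic.tau (octic (r - 2) (sec w b))} := by
    rw [Set.ofPred_forall]
    exact isClosed_iInter fun b => isClosed_eq ((continuous_octic _).comp (continuous_sec _))
      (continuous_of_discreteTopology.comp ((continuous_octic _).comp (continuous_sec _)))
  exact h1.inter h2

theorem mem_sectionSubgroup_of {w : W} (h0 : sec w false ∈ G 1 r) (h1 : sec w true ∈ G 1 r)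
    (h : octic (r - 2) (sec w true) = Octic.tau (octic (r - 2) (sec w false))) :
    w ∈ sectionSubgroup r := by
  refine ⟨?_, ?_⟩ <;> rintro (_ | _)
  · exact h0
  · exact h1
  · exact h
  · simp [h]

theorem G_le_sectionSubgroup (hr : 3 ≤ r) : G 1 r ≤ sectionSubgroup r := by
  refine G_le_of_isClosed isClosed_sectionSubgroup fun i h1 h2 => ?_
  rcases eq_or_ne i 1 with rfl | hi
  · rw [gen_one]
    exact mem_sectionSubgroup_of (one_mem _) (one_mem _) (by simp)
  rcases eq_or_ne i 2 with rfl | hi'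
  · rw [gen_succ 1 r le_rfl]
    refine mem_sectionSubgroup_of (gen_mem_G le_rfl (by omega)) (gen_mem_G (by omega) le_rfl) ?_
    rw [sec_pair_true, sec_pair_false, octic_gen_one, octic_gen_last hr]
    decide
  · rw [gen_of_ne 1 r i hi hi']
    refine mem_sectionSubgroup_of (gen_mem_G (by omega) (by omega)) (one_mem _) ?_
    rw [sec_pair_true, sec_pair_false, octic_gen_of_ne hr (by omega) (by omega)]
    simp

theorem sigma_mem_G (hr : 3 ≤ r) : sigma ∈ G 1 r := by
  rw [← gen_one 1 r]
  exact gen_mem_G le_rfl (by omega)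

/-- Restriction to `⟨gen 1 r 1, gen 1 r r⟩` splits `octic (r - 2)`. -/
def lift (r : ℕ) : Octic →* W where
  toFun a := sigma ^ a.e.toNat * pair (gen 1 r (r - 1) ^ a.x.toNat) (gen 1 r (r - 1) ^ a.y.toNat)
  map_one' := by simp [Octic.one_def, pair_one_one]
  map_mul' a b := by
    have h := gen_mul_self 1 r (r - 1)
    obtain ⟨e, x, y⟩ := a
    obtain ⟨e', x', y'⟩ := b
    refine ext_of_sec ?_ ?_
    · cases e <;> cases e' <;> simp [Octic.mul_def]
    · have hx : ∀ x x' : Bool, gen 1 r (r - 1) ^ (x ^^ x').toNat =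
          gen 1 r (r - 1) ^ x.toNat * gen 1 r (r - 1) ^ x'.toNat := by
        rintro (_ | _) (_ | _) <;> simp [h]
      have hs : ∀ (e : Bool) b, sec (sigma ^ e.toNat) b = 1 := by
        rintro (_ | _) b <;> simp
      rintro (_ | _) <;> cases e' <;> simp [Octic.mul_def, hs, hx]

theorem lift_reflection : lift r ⟨true, false, false⟩ = gen 1 r 1 := by
  simp [lift, gen_one, pair_one_one]

theorem lift_reflection' (hr : 3 ≤ r) : lift r ⟨false, true, false⟩ = gen 1 r r := by
  simp [lift, gen_last hr]

theorem lift_z : lift r Octic.z = diag (gen 1 r (r - 1)) := by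
  simp [lift, Octic.z, diag]

theorem octic_hom_induction {S : Subgroup Octic} (h1 : ⟨true, false, false⟩ ∈ S)
    (h2 : ⟨false, true, false⟩ ∈ S) (a : Octic) : a ∈ S := by
  have : Subgroup.closure {(⟨true, false, false⟩ : Octic), ⟨false, true, false⟩} ≤ S := by
    rw [Subgroup.closure_le]
    rintro _ (rfl | rfl)
    exacts [h1, h2]
  rw [Octic.closure_reflections] at this
  exact this trivial

theorem octic_lift (hr : 3 ≤ r) (a : Octic) : octic (r - 2) (lift r a) = a :=
  octic_hom_induction (S := ((octic (r - 2)).comp (lift r)).eqLocus (MonoidHom.id _))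
    (by change octic _ (lift r _) = _; rw [lift_reflection, octic_gen_one]; rfl)
    (by change octic _ (lift r _) = _; rw [lift_reflection' hr, octic_gen_last hr]; rfl) a

theorem lift_mem_G (hr : 3 ≤ r) (a : Octic) : lift r a ∈ G 1 r :=
  octic_hom_induction (S := (G 1 r).comap (lift r))
    (by simpa [lift_reflection] using gen_mem_G le_rfl (by omega))
    (by simpa [lift_reflection' hr] using gen_mem_G (by omega) le_rfl) a

/-- The embedding `W × W → W`, `(u, v) ↦ pair u v`, as a homomorphism. -/
def pairHom : W × W →* W where
  toFun p := pair p.1 p.2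
  map_one' := pair_one_one
  map_mul' p q := (pair_mul p.1 p.2 q.1 q.2).symm

theorem sigma_mul_pair_mul_sigma (u v : W) : sigma * pair u v * sigma = pair v u :=
  ext_of_sec (by simp) (by rintro (_ | _) <;> simp)

theorem pair_swap_mem_G (hr : 3 ≤ r) {u v : W} (h : pair u v ∈ G 1 r) : pair v u ∈ G 1 r := by
  rw [← sigma_mul_pair_mul_sigma]
  exact mul_mem (mul_mem (sigma_mem_G hr) h) (sigma_mem_G hr)

/-- On the two generating reflections this is a_2 = (a_1, a_r) and its conjugate by `sigma`. -/
theorem pair_lift_mem_G (hr : 3 ≤ r) (a : Octic) :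
    pair (lift r a) (lift r (Octic.tau a)) ∈ G 1 r := by
  have h1 : Octic.tau ⟨true, false, false⟩ = ⟨false, true, false⟩ := by decide
  have h2 : Octic.tau ⟨false, true, false⟩ = ⟨true, false, false⟩ := by decide
  have h3 : pair (gen 1 r 1) (gen 1 r r) ∈ G 1 r := by
    rw [← gen_succ 1 r le_rfl]
    exact gen_mem_G (by omega) (by omega)
  refine octic_hom_induction
    (S := (G 1 r).comap (pairHom.comp ((lift r).prod ((lift r).comp Octic.tau)))) ?_ ?_ a
  · change pair (lift r _) (lift r (Octic.tau _)) ∈ G 1 r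
    rw [h1, lift_reflection, lift_reflection' hr]
    exact h3
  · change pair (lift r _) (lift r (Octic.tau _)) ∈ G 1 r
    rw [h2, lift_reflection, lift_reflection' hr]
    exact pair_swap_mem_G hr h3

/-- The subgroup of all `u` with `pair u 1 ∈ G`. -/
def leftSubgroup (r : ℕ) : Subgroup W :=
  (G 1 r).comap (pairHom.comp (MonoidHom.inl W W))

theorem mem_leftSubgroup {u : W} : u ∈ leftSubgroup r ↔ pair u 1 ∈ G 1 r := Iff.rfl

theorem conj_mem_leftSubgroup {u g v : W} (hu : u ∈ leftSubgroup r)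
    (h : pair g v ∈ G 1 r) : g * u * g⁻¹ ∈ leftSubgroup r := by
  rw [mem_leftSubgroup] at hu ⊢
  have := mul_mem (mul_mem h hu) (inv_mem h)
  have e : pair g v * pair u 1 * (pair g v)⁻¹ = pair (g * u * g⁻¹) 1 :=
    ext_of_sec (by simp) (by rintro (_ | _) <;> simp)
  rwa [e] at this

/-- The product of `leftSubgroup` with the image of `lift`. -/
def leftLiftSubgroup (hr : 3 ≤ r) : Subgroup W where
  carrier := {u | u * (lift r (octic (r - 2) u))⁻¹ ∈ leftSubgroup r}
  one_mem' := by simp [one_mem]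
  mul_mem' {u v} hu hv := by
    -- With ℓ(u) the lift of the D-image of u: u v ℓ(uv)⁻¹ = (u ℓ(u)⁻¹) · ℓ(u) (v ℓ(v)⁻¹) ℓ(u)⁻¹.
    have h := mul_mem (show _ ∈ leftSubgroup r from hu)
      (conj_mem_leftSubgroup hv (pair_lift_mem_G hr (octic (r - 2) u)))
    change _ ∈ leftSubgroup r
    rw [map_mul, map_mul]
    convert h using 1
    group
  inv_mem' {u} hu := by
    have h := conj_mem_leftSubgroup (inv_mem (show _ ∈ leftSubgroup r from hu))
      (pair_lift_mem_G hr (octic (r - 2) u)⁻¹)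
    change _ ∈ leftSubgroup r
    rw [map_inv, map_inv] at *
    convert h using 1
    group

/-- The generators a_1 and a_r are lifts, while for 1 < i < r the element (a_i, 1) is the generator
a_{i+1}. -/
theorem G_le_leftLiftSubgroup (hr : 3 ≤ r) : G 1 r ≤ leftLiftSubgroup hr := by
  refine G_le_of_isClosed ?_ fun i h1 h2 => ?_
  · have h : IsClosed (leftSubgroup r : Set W) := (isClosed_G 1 r).preimage (continuous_pair_left 1)
    exact h.preimage (continuous_id.mul
      (continuous_of_discreteTopology.comp (continuous_octic (r - 2))).inv)
  · change _ ∈ leftSubgroup r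
    rcases eq_or_ne i 1 with rfl | hi
    · rw [octic_gen_one, lift_reflection, mul_inv_cancel]
      exact one_mem _
    rcases eq_or_ne i r with rfl | hi'
    · rw [octic_gen_last hr, lift_reflection' hr, mul_inv_cancel]
      exact one_mem _
    · rw [octic_gen_of_ne hr (by omega) (by omega), map_one, inv_one, mul_one, mem_leftSubgroup]
      have := gen_of_ne 1 r (i + 1) (by omega) (by omega)
      rw [Nat.add_sub_cancel] at this
      rw [← this]
      exact gen_mem_G (by omega) (by omega)

/-- The branching property: the kernel of G → D embeds in `G` on a single subtree. -/
theorem pair_one_mem_G (hr : 3 ≤ r) {u : W} (hu : u ∈ G 1 r) (h : octic (r - 2) u = 1) :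
    pair u 1 ∈ G 1 r := by
  have : u * (lift r (octic (r - 2) u))⁻¹ ∈ leftSubgroup r := G_le_leftLiftSubgroup hr hu
  rwa [h, map_one, inv_one, mul_one] at this

/-- The self-similar description of `G`. -/
theorem G_eq_sectionSubgroup (hr : 3 ≤ r) : G 1 r = sectionSubgroup r := by
  refine le_antisymm (G_le_sectionSubgroup hr) ?_
  have key : ∀ w ∈ sectionSubgroup r, swaps w = false → w ∈ G 1 r := by
    rintro w ⟨h1, h2⟩ h
    rw [eq_pair_of_swaps h]
    set u := sec w false
    set v := sec w true
    have h2 : octic (r - 2) v = Octic.tau (octic (r - 2) u) := h2 false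
    set a := octic (r - 2) u
    -- Factor (u, v) as (u ℓ(a)⁻¹, 1) (1, v ℓ(τa)⁻¹) (ℓ(a), ℓ(τa)), with ℓ the lift and τ = `tau`.
    have hu : pair (u * (lift r a)⁻¹) 1 ∈ G 1 r :=
      pair_one_mem_G hr (mul_mem (h1 _) (inv_mem (lift_mem_G hr a))) (by simp [octic_lift hr, a])
    have hv : pair (v * (lift r (Octic.tau a))⁻¹) 1 ∈ G 1 r :=
      pair_one_mem_G hr (mul_mem (h1 _) (inv_mem (lift_mem_G hr _))) (by simp [octic_lift hr, h2])
    have := mul_mem (mul_mem hu (pair_swap_mem_G hr hv)) (pair_lift_mem_G hr a)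
    simpa [pair_mul] using this
  intro w hw
  rcases h : swaps w
  · exact key w hw h
  · have hs := G_le_sectionSubgroup hr (sigma_mem_G hr)
    have := mul_mem (sigma_mem_G hr) (key (sigma * w) (mul_mem hs hw) (by simp [h]))
    rwa [← mul_assoc, sigma_mul_self, one_mul] at this

theorem mem_G_iff (hr : 3 ≤ r) {w : W} : w ∈ G 1 r ↔ sec w false ∈ G 1 r ∧ sec w true ∈ G 1 r ∧
    octic (r - 2) (sec w true) = Octic.tau (octic (r - 2) (sec w false)) := by
  constructor
  · intro h
    have := G_le_sectionSubgroup hr h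
    exact ⟨this.1 _, this.1 _, this.2 false⟩
  · rintro ⟨h0, h1, h⟩
    rw [G_eq_sectionSubgroup hr]
    exact mem_sectionSubgroup_of h0 h1 h

end

/-! ### The normalizer, its diagonal elements and the w_i. -/

theorem mem_N_of {s r : ℕ} {w : W} (h : ∀ g ∈ G s r, w * g * w⁻¹ ∈ G s r)
    (h' : ∀ g ∈ G s r, w⁻¹ * g * w ∈ G s r) : w ∈ N s r := by
  refine Subgroup.mem_normalizer_iff.2 fun g => ⟨h g, fun hg => ?_⟩
  have := h' _ hg
  simpa [mul_assoc] using this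

theorem conj_mem_G {s r : ℕ} {w g : W} (hw : w ∈ N s r) (hg : g ∈ G s r) : w * g * w⁻¹ ∈ G s r :=
  (Subgroup.mem_normalizer_iff.1 hw g).1 hg

theorem G_le_N (s r : ℕ) : G s r ≤ N s r := Subgroup.le_normalizer

theorem isClosed_N (s r : ℕ) : IsClosed (N s r : Set W) := by
  have : (N s r : Set W) = ⋂ g ∈ G s r, {w : W | w * g * w⁻¹ ∈ G s r ∧ w⁻¹ * g * w ∈ G s r} := by
    ext w
    simp only [Set.mem_iInter]
    refine ⟨fun hw g hg => ⟨conj_mem_G hw hg, ?_⟩, fun h =>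
      mem_N_of (fun g hg => (h g hg).1) (fun g hg => (h g hg).2)⟩
    simpa using conj_mem_G (inv_mem hw) hg
  rw [this]
  refine isClosed_biInter fun g _ => IsClosed.inter ?_ ?_
  · exact (isClosed_G s r).preimage (f := fun w => w * g * w⁻¹) (by fun_prop)
  · exact (isClosed_G s r).preimage (f := fun w => w⁻¹ * g * w) (by fun_prop)

/-- The elements of `N` with central image in the dihedral group. -/
def centralN (r : ℕ) : Subgroup W := N 1 r ⊓ (Subgroup.center Octic).comap (octic (r - 2))

/-- The elements of `G` with central image in the dihedral group. -/
def centralG (r : ℕ) : Subgroup W := G 1 r ⊓ (Subgroup.center Octic).comap (octic (r - 2))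

section

variable {r : ℕ}

theorem centralG_le_centralN : centralG r ≤ centralN r := inf_le_inf_right _ (G_le_N 1 r)

theorem mem_centralG_of {g : W} (hg : g ∈ G 1 r) (h : g ∈ centralN r) : g ∈ centralG r := ⟨hg, h.2⟩

theorem isClosed_centralN : IsClosed (centralN r : Set W) :=
  (isClosed_N 1 r).inter ((isClosed_discrete (Subgroup.center Octic : Set Octic)).preimage
    (continuous_octic _))

theorem conj_mem_centralG {w g : W} (hw : w ∈ centralN r) (hg : g ∈ centralG r) :
    w * g * w⁻¹ ∈ centralG r :=
  mem_centralG_of (conj_mem_G hw.1 hg.1)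
    (mul_mem (mul_mem hw (centralG_le_centralN hg)) (inv_mem hw))

theorem octic_conj_of_mem_centralN {w : W} (hw : w ∈ centralN r) (g : W) :
    octic (r - 2) (w * g * w⁻¹) = octic (r - 2) g := by
  rw [map_mul, map_mul, ← Subgroup.mem_center_iff.1 hw.2, map_inv, mul_inv_cancel_right]

/-- Conjugation by `u` changes no D-image, so the `tau`-relation between the sections of `g`
survives. -/
theorem conj_diag_mem_G (hr : 3 ≤ r) {u g : W} (hu : u ∈ centralN r) (hg : g ∈ G 1 r) :
    diag u * g * (diag u)⁻¹ ∈ G 1 r := by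
  have hs : ∀ b, sec (diag u * g * (diag u)⁻¹) b = u * sec g b * u⁻¹ := fun b => by simp
  obtain ⟨h0, h1, h⟩ := (mem_G_iff hr).1 hg
  rw [mem_G_iff hr, hs, hs, octic_conj_of_mem_centralN hu, octic_conj_of_mem_centralN hu]
  exact ⟨conj_mem_G hu.1 h0, conj_mem_G hu.1 h1, h⟩

theorem diag_mem_centralN (hr : 3 ≤ r) {u : W} (hu : u ∈ centralN r) : diag u ∈ centralN r := by
  refine ⟨mem_N_of (fun g hg => conj_diag_mem_G hr hu hg) fun g hg => ?_,
    octic_diag_mem_center _ u⟩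
  simpa using conj_diag_mem_G hr (inv_mem hu) hg

theorem diag_mem_centralG (hr : 3 ≤ r) {g : W} (hg : g ∈ centralG r) : diag g ∈ centralG r := by
  refine ⟨(mem_G_iff hr).2 ?_, octic_diag_mem_center _ g⟩
  rw [sec_diag, sec_diag]
  exact ⟨hg.1, hg.1, (Octic.tau_of_mem_center hg.2).symm⟩

theorem wElt_succ (i : ℕ) : wElt 1 r (i + 1) = diag (wElt 1 r i) := rfl

theorem wElt_zero (hr : 3 ≤ r) : wElt 1 r 0 = pair 1 (lift r Octic.z) := by
  have h : (⟨true, false, false⟩ * ⟨false, true, false⟩ : Octic) ^ 2 = Octic.z := by decide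
  rw [wElt, ← h, map_pow, map_mul, lift_reflection, lift_reflection' hr]

theorem lift_z_mul_self : lift r Octic.z * lift r Octic.z = 1 := by
  rw [← map_mul, show Octic.z * Octic.z = 1 by decide, map_one]

theorem lift_z_mem_centralG (hr : 3 ≤ r) : lift r Octic.z ∈ centralG r :=
  Subgroup.mem_inf.2 ⟨lift_mem_G hr _, by
    rw [Subgroup.mem_comap, octic_lift hr, Octic.mem_center]
    exact Or.inr rfl⟩

theorem wElt_zero_mul_self (hr : 3 ≤ r) : wElt 1 r 0 * wElt 1 r 0 = 1 := by
  rw [wElt_zero hr, pair_mul, lift_z_mul_self, one_mul, pair_one_one]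

/-- If `g` does not swap, one section is conjugated by a lift of z, which leaves its D-image alone.
If it swaps, both D-images are multiplied by the `tau`-fixed z. -/
theorem wElt_zero_mem_centralN (hr : 3 ≤ r) : wElt 1 r 0 ∈ centralN r := by
  have hz := lift_z_mem_centralG hr
  have hinv : (wElt 1 r 0)⁻¹ = wElt 1 r 0 := inv_eq_of_mul_eq_one_left (wElt_zero_mul_self hr)
  have hoz := octic_lift hr Octic.z
  have hc : ∀ a : Octic, Octic.z * a = a * Octic.z := by decide
  have key : ∀ g ∈ G 1 r, wElt 1 r 0 * g * wElt 1 r 0 ∈ G 1 r := by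
    intro g hg
    obtain ⟨h0, h1, h⟩ := (mem_G_iff hr).1 hg
    rw [mem_G_iff hr, wElt_zero hr]
    cases hs : swaps g
    · simp only [sec_mul, swaps_pair, hs, Bool.xor_false, sec_pair_false, sec_pair_true, one_mul,
        mul_one, map_mul, hoz, Bool.xor_self]
      refine ⟨h0, mul_mem (mul_mem hz.1 h1) hz.1, ?_⟩
      rw [hc, mul_assoc, show Octic.z * Octic.z = 1 by decide, mul_one, h]
    · simp only [sec_mul, swaps_pair, hs, Bool.xor_false, sec_pair_false, sec_pair_true, one_mul,
        mul_one, map_mul, hoz, Bool.xor_true, Bool.not_false, Bool.not_true, Octic.tau_z]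
      refine ⟨mul_mem hz.1 h0, mul_mem h1 hz.1, ?_⟩
      rw [hc, h]
  refine Subgroup.mem_inf.2 ⟨mem_N_of (fun g hg => ?_) (fun g hg => ?_), ?_⟩
  · rw [hinv]
    exact key g hg
  · rw [hinv]
    exact key g hg
  · rw [wElt_zero hr, lift_z, Subgroup.mem_comap, octic_apply]
    simp only [sec_pair_false, sec_pair_true, swaps_pair, par_one]
    -- Since r - 2 ≥ 1, the parity is a sum over two equal sections.
    have hd : par (r - 2) (diag (gen 1 r (r - 1))) = false := by
      obtain ⟨m, hm⟩ : ∃ m, r - 2 = m + 1 := ⟨r - 3, by omega⟩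
      simp [hm, par]
    rw [hd]
    exact one_mem (Subgroup.center Octic)

theorem wElt_mem_centralN (hr : 3 ≤ r) (i : ℕ) : wElt 1 r i ∈ centralN r := by
  induction i with
  | zero => exact wElt_zero_mem_centralN hr
  | succ i ih => exact diag_mem_centralN hr ih

theorem wElt_zero_pow_add (hr : 3 ≤ r) : ∀ a b : ZMod 2,
    wElt 1 r 0 ^ (a + b).val = wElt 1 r 0 ^ a.val * wElt 1 r 0 ^ b.val := by
  have h2 : wElt 1 r 0 ^ 2 = 1 := by rw [sq, wElt_zero_mul_self hr]
  intro a b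
  rw [← pow_add, ZMod.val_add, ← pow_eq_pow_mod _ h2]

/-- Elements `diag u` commute with `wElt 1 r 0` modulo `G`. -/
theorem commutator_mem_centralG (hr : 3 ≤ r) {u : W} (hu : u ∈ centralN r) (n : ℕ) :
    diag u * wElt 1 r 0 ^ n * (diag u)⁻¹ * (wElt 1 r 0 ^ n)⁻¹ ∈ centralG r := by
  have hz : lift r Octic.z ^ n ∈ centralG r := pow_mem (lift_z_mem_centralG hr) n
  have hp : wElt 1 r 0 ^ n = pair 1 (lift r Octic.z ^ n) := by
    have := map_pow pairHom (1, lift r Octic.z) n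
    rw [wElt_zero hr]
    simpa [pairHom] using this.symm
  refine mem_centralG_of ?_ ?_
  -- The commutator lives on one subtree and has trivial D-image there, so the branching property
  -- applies.
  · have e : diag u * wElt 1 r 0 ^ n * (diag u)⁻¹ * (wElt 1 r 0 ^ n)⁻¹ =
        pair 1 (u * lift r Octic.z ^ n * u⁻¹ * (lift r Octic.z ^ n)⁻¹) := by
      rw [hp]
      refine ext_of_sec (by simp) ?_
      rintro (_ | _) <;> simp
    rw [e]
    refine pair_swap_mem_G hr (pair_one_mem_G hr ?_ ?_)
    · exact mul_mem (conj_mem_G hu.1 hz.1) (inv_mem hz.1)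
    · rw [map_mul, octic_conj_of_mem_centralN hu, map_inv, mul_inv_cancel]
  · have hd := diag_mem_centralN hr hu
    have hw := pow_mem (wElt_zero_mem_centralN hr) n
    exact mul_mem (mul_mem (mul_mem hd hw) (inv_mem hd)) (inv_mem hw)

/-! Decomposition of the elements of `N`. -/

/-- Every `g` in `G` is the first section of some element of `G`, which `w` conjugates into `G`. -/
theorem conj_sec_mem_G (hr : 3 ≤ r) {w g : W} (hw : w ∈ N 1 r) (hs : swaps w = false)
    (hg : g ∈ G 1 r) : sec w false * g * (sec w false)⁻¹ ∈ G 1 r := by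
  have h : pair g (lift r (Octic.tau (octic (r - 2) g))) ∈ G 1 r :=
    (mem_G_iff hr).2 ⟨hg, lift_mem_G hr _, octic_lift hr _⟩
  have := ((mem_G_iff hr).1 (conj_mem_G hw h)).1
  simpa [hs] using this

theorem sec_mem_N (hr : 3 ≤ r) {w : W} (hw : w ∈ N 1 r) (hs : swaps w = false) :
    sec w false ∈ N 1 r :=
  mem_N_of (fun g hg => conj_sec_mem_G hr hw hs hg) fun g hg => by
    simpa [hs] using conj_sec_mem_G hr (inv_mem hw) (by simpa using hs) hg

theorem exists_decomposition_of_octic_sec (hr : 3 ≤ r) {w : W} (hw : w ∈ N 1 r)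
    (hs : swaps w = false) (h1 : octic (r - 2) (sec w false) = 1) :
    ∃ c : ZMod 2, ∃ u ∈ centralN r, ∃ g ∈ G 1 r, w = g * wElt 1 r 0 ^ c.val * diag u := by
  set u := sec w false
  set v := sec w true
  have hwp : w = pair u v := eq_pair_of_swaps hs
  have hu : u ∈ centralN r :=
    Subgroup.mem_inf.2 ⟨sec_mem_N hr hw hs, by rw [Subgroup.mem_comap, h1]; exact one_mem _⟩
  set g := v * u⁻¹
  -- v u⁻¹ is a section of the conjugate of `sigma` by `w`.
  have hg : g ∈ G 1 r := by
    have := ((mem_G_iff hr).1 (conj_mem_G hw (sigma_mem_G hr))).1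
    simpa [hs] using this
  have hov : octic (r - 2) v = octic (r - 2) g := by simp [g, h1]
  have hc : octic (r - 2) g ∈ Subgroup.center Octic := by
    rw [Subgroup.mem_center_iff]
    intro x
    -- The first section keeps D-image `tau x`, so the `tau`-relation forces conjugation by the
    -- D-image of `g` to fix `x`.
    have := ((mem_G_iff hr).1 (conj_mem_G hw (pair_lift_mem_G hr (Octic.tau x)))).2.2
    rw [hwp] at this
    simp only [sec_mul, sec_inv, swaps_inv, swaps_pair, Bool.xor_false, sec_pair_false,
      sec_pair_true, map_mul, map_inv, octic_lift hr, Octic.tau_tau, h1, hov, one_mul, inv_one,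
      mul_one] at this
    exact (mul_inv_eq_iff_eq_mul.1 this).symm
  have hwg : w = pair 1 g * diag u := by
    rw [hwp]
    exact ext_of_sec (by simp) (by rintro (_ | _) <;> simp [g])
  rcases (Octic.mem_center _).1 hc with h | h
  · refine ⟨0, u, hu, _, pair_swap_mem_G hr (pair_one_mem_G hr hg h), ?_⟩
    simpa using hwg
  · refine ⟨1, u, hu, pair 1 (g * lift r Octic.z), pair_swap_mem_G hr (pair_one_mem_G hr
      (mul_mem hg (lift_mem_G hr _)) ?_), ?_⟩
    · rw [map_mul, h, octic_lift hr]
      decide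
    · rw [ZMod.val_one, pow_one, wElt_zero hr, pair_mul, mul_assoc, lift_z_mul_self, mul_one,
        mul_one, hwg]

theorem exists_decomposition (hr : 3 ≤ r) {w : W} (hw : w ∈ centralN r) :
    ∃ c : ZMod 2, ∃ u ∈ centralN r, ∃ g ∈ centralG r, w = g * wElt 1 r 0 ^ c.val * diag u := by
  have hs : swaps w = false := by
    have : ∀ a : Octic, a = 1 ∨ a = Octic.z → a.e = false := by decide
    exact this _ ((Octic.mem_center _).1 hw.2)
  -- Left multiplication by `m` in `G` makes the D-image of the first section trivial.
  set a := (octic (r - 2) (sec w false))⁻¹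
  have hm := pair_lift_mem_G hr a
  set m := pair (lift r a) (lift r (Octic.tau a))
  obtain ⟨c, u, hu, g, hg, h⟩ := exists_decomposition_of_octic_sec hr
    (mul_mem (G_le_N 1 r hm) hw.1) (by simp [m, hs])
    (by simp [m, hs, octic_lift hr, a])
  have hw' : w = m⁻¹ * g * wElt 1 r 0 ^ c.val * diag u := by
    rw [mul_assoc, mul_assoc, ← mul_assoc g, ← h, inv_mul_cancel_left]
  refine ⟨c, u, hu, m⁻¹ * g, mem_centralG_of (mul_mem (inv_mem hm) hg) ?_, hw'⟩
  have hd := mul_mem (pow_mem (wElt_zero_mem_centralN hr) c.val) (diag_mem_centralN hr hu)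
  have : m⁻¹ * g = w * (wElt 1 r 0 ^ c.val * diag u)⁻¹ := by
    rw [eq_mul_inv_iff_mul_eq, ← mul_assoc]
    exact hw'.symm
  rw [this]
  exact mul_mem hw (inv_mem hd)

/-! Partial products. -/

theorem partialProd_zero (s r : ℕ) (k : ℕ → ZMod 2) : partialProd s r k 0 = 1 := rfl

theorem partialProd_succ (s r : ℕ) (k : ℕ → ZMod 2) (n : ℕ) :
    partialProd s r k (n + 1) = partialProd s r k n * wElt s r n ^ (k n).val := by
  simp [partialProd, List.range_succ]

theorem partialProd_succ' (k : ℕ → ZMod 2) (n : ℕ) :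
    partialProd 1 r k (n + 1) =
      wElt 1 r 0 ^ (k 0).val * diag (partialProd 1 r (fun i => k (i + 1)) n) := by
  simp [partialProd, List.range_succ_eq_map, map_list_prod, List.map_map, Function.comp_def,
    wElt_succ]

theorem partialProd_mem_centralN (hr : 3 ≤ r) (k : ℕ → ZMod 2) (n : ℕ) :
    partialProd 1 r k n ∈ centralN r := by
  induction n with
  | zero => exact one_mem _
  | succ n ih =>
    rw [partialProd_succ]
    exact mul_mem ih (pow_mem (wElt_mem_centralN hr n) _)

/-- The induction needs `centralG` rather than `G`, since `diag` of an element of `G` need not lie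
in `G`. -/
theorem partialProd_add (hr : 3 ≤ r) (n : ℕ) : ∀ k l : ℕ → ZMod 2,
    partialProd 1 r k n * partialProd 1 r l n * (partialProd 1 r (k + l) n)⁻¹ ∈ centralG r := by
  induction n with
  | zero => intro k l; simp [partialProd_zero, one_mem]
  | succ n ih =>
    intro k l
    have hA := partialProd_mem_centralN hr (fun i => k (i + 1)) n
    have hg := ih (fun i => k (i + 1)) (fun i => l (i + 1))
    have hkl : (fun i => (k + l) (i + 1)) = (fun i => k (i + 1)) + fun i => l (i + 1) := rfl
    rw [partialProd_succ', partialProd_succ', partialProd_succ', hkl, Pi.add_apply,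
      wElt_zero_pow_add hr]
    set A := partialProd 1 r (fun i => k (i + 1)) n
    set B := partialProd 1 r (fun i => l (i + 1)) n
    set C := partialProd 1 r ((fun i => k (i + 1)) + fun i => l (i + 1)) n
    -- `h1` moves the power of w_1 past diag(A); `h2` handles the error diag(A B C⁻¹) of the shifted
    -- sequences.
    have h1 := conj_mem_centralG (pow_mem (wElt_zero_mem_centralN hr) (k 0).val)
      (commutator_mem_centralG hr hA (l 0).val)
    have h2 := conj_mem_centralG (mul_mem (pow_mem (wElt_zero_mem_centralN hr) (k 0).val)
      (pow_mem (wElt_zero_mem_centralN hr) (l 0).val)) (diag_mem_centralG hr hg)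
    convert mul_mem h1 h2 using 1
    rw [map_mul, map_mul, map_inv]
    group

theorem wElt_apply_of_length_le (i : ℕ) : ∀ t : List Bool, t.length ≤ i + 1 → wElt 1 r i t = t := by
  induction i with
  | zero =>
    rintro (_ | ⟨b, _ | ⟨c, t⟩⟩) ht
    · exact map_root _
    · rw [map_cons, map_root, wElt, swaps_pair, Bool.xor_false]
    · simp at ht
  | succ i ih =>
    rintro (_ | ⟨b, t⟩) ht
    · exact map_root _
    · rw [map_cons, wElt_succ, swaps_diag, sec_diag, Bool.xor_false,
        ih t (by simpa using ht)]

theorem pow_apply_of_apply_eq {w : W} {t : List Bool} (h : w t = t) (n : ℕ) : (w ^ n) t = t := by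
  induction n with
  | zero => rfl
  | succ n ih => rw [pow_succ, RelIso.mul_apply, h, ih]

/-- Makes the remainder diag^n(u) tend to 1, whatever the `u` at stage n. -/
theorem diag_iterate_apply (u : W) (n : ℕ) :
    ∀ t : List Bool, t.length ≤ n → (diag^[n] u) t = t := by
  induction n with
  | zero =>
    intro t ht
    rw [List.length_eq_zero_iff.1 (Nat.le_zero.1 ht)]
    exact map_root _
  | succ n ih =>
    rintro (_ | ⟨b, t⟩) ht
    · exact map_root _
    · rw [Function.iterate_succ_apply', map_cons, swaps_diag, sec_diag, Bool.xor_false,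
        ih t (by simpa using ht)]

theorem partialProd_succ_apply (k : ℕ → ZMod 2) (n : ℕ) (t : List Bool) (ht : t.length ≤ n) :
    partialProd 1 r k (n + 1) t = partialProd 1 r k n t := by
  rw [partialProd_succ, RelIso.mul_apply,
    pow_apply_of_apply_eq (wElt_apply_of_length_le n t (by omega))]

/-- The infinite product of the `wElt 1 r i ^ (k i).val`. -/
noncomputable def infProd (r : ℕ) (k : ℕ → ZMod 2) : W :=
  (exists_limit (f := partialProd 1 r k) (partialProd_succ_apply k)).choose

theorem partialProd_apply (k : ℕ → ZMod 2) (n : ℕ) (t : List Bool) (ht : t.length ≤ n) :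
    partialProd 1 r k n t = infProd r k t :=
  (exists_limit (f := partialProd 1 r k) (partialProd_succ_apply k)).choose_spec n t ht

theorem tendsto_partialProd (k : ℕ → ZMod 2) :
    Tendsto (partialProd 1 r k) atTop (𝓝 (infProd r k)) :=
  tendsto_of_eventually_eq fun t => (eventually_ge_atTop t.length).mono fun n hn =>
    partialProd_apply k n t hn

theorem infProd_eq (k : ℕ → ZMod 2) :
    infProd r k = wElt 1 r 0 ^ (k 0).val * diag (infProd r fun i => k (i + 1)) := by
  ext1 t
  rw [← partialProd_apply k (t.length + 1) t (by omega), partialProd_succ', RelIso.mul_apply,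
    RelIso.mul_apply]
  rcases t with _ | ⟨b, t⟩
  · simp only [map_root]
  · rw [map_cons (diag _), map_cons (diag _), swaps_diag, swaps_diag, sec_diag, sec_diag,
      partialProd_apply _ _ t (by simp)]

theorem infProd_mem_centralN (hr : 3 ≤ r) (k : ℕ → ZMod 2) : infProd r k ∈ centralN r :=
  isClosed_centralN.mem_of_tendsto (tendsto_partialProd k)
    (Eventually.of_forall fun n => partialProd_mem_centralN hr k n)

theorem continuous_partialProd (n : ℕ) : Continuous fun k => partialProd 1 r k n := by
  induction n with
  | zero => exact continuous_const
  | succ n ih =>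
    simp only [partialProd_succ]
    exact ih.mul ((continuous_of_discreteTopology (f := fun c : ZMod 2 => wElt 1 r n ^ c.val)).comp
      (continuous_apply n))

theorem continuous_infProd : Continuous (infProd r) :=
  continuous_of_fiber fun t u => by
    have := (isOpen_fiber t u).preimage (continuous_partialProd (r := r) t.length)
    simpa only [Set.preimage_ofPred_eq, partialProd_apply _ _ t le_rfl] using this

theorem infProd_add (hr : 3 ≤ r) (k l : ℕ → ZMod 2) :
    infProd r k * infProd r l * (infProd r (k + l))⁻¹ ∈ G 1 r :=
  (isClosed_G 1 r).mem_of_tendsto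
    (((tendsto_partialProd k).mul (tendsto_partialProd l)).mul (tendsto_partialProd (k + l)).inv)
    (Eventually.of_forall fun n => (partialProd_add hr n k l).1)

/-! ### Injectivity and surjectivity modulo `G`. -/

theorem of_infProd_mem_G (hr : 3 ≤ r) {k : ℕ → ZMod 2} (h : infProd r k ∈ G 1 r) :
    k 0 = 0 ∧ infProd r (fun i => k (i + 1)) ∈ G 1 r := by
  have hc := (infProd_mem_centralN hr fun i => k (i + 1)).2
  rw [infProd_eq, wElt_zero hr] at h
  set v := infProd r fun i => k (i + 1)
  have h01 : ∀ c : ZMod 2, c = 0 ∨ c = 1 := by decide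
  rcases h01 (k 0) with h0 | h0 <;> rw [h0] at h
  · rw [ZMod.val_zero, pow_zero, one_mul, mem_G_iff hr, sec_diag] at h
    exact ⟨h0, h.1⟩
  · rw [ZMod.val_one, pow_one, mem_G_iff hr] at h
    have := h.2.2
    simp only [sec_mul, swaps_diag, Bool.xor_false, sec_pair_true, sec_pair_false, sec_diag,
      one_mul, map_mul, octic_lift hr, Octic.tau_of_mem_center hc] at this
    -- With first bit 1 the sections have D-images x and z x, x central; `tau` fixes x, forcing z =
    -- 1.
    exact absurd (mul_eq_right.1 this) (by decide)

theorem eq_zero_of_infProd_mem_G (hr : 3 ≤ r) {k : ℕ → ZMod 2} (h : infProd r k ∈ G 1 r) :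
    k = 0 := by
  funext n
  induction n generalizing k with
  | zero => exact (of_infProd_mem_G hr h).1
  | succ n ih => exact ih (of_infProd_mem_G hr h).2

theorem exists_infProd_of_mem_centralN (hr : 3 ≤ r) {w : W} (hw : w ∈ centralN r) :
    ∃ k, w * (infProd r k)⁻¹ ∈ G 1 r := by
  have : ∀ w : centralN r, ∃ c : ZMod 2, ∃ u : centralN r, ∃ g ∈ centralG r,
      (w : W) = g * wElt 1 r 0 ^ c.val * diag (u : W) := by
    rintro ⟨w, hw⟩
    obtain ⟨c, u, hu, g, hg, h⟩ := exists_decomposition hr hw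
    exact ⟨c, ⟨u, hu⟩, g, hg, h⟩
  choose c ν γ hγ h using this
  -- The bit of the i-th iterated remainder is the i-th exponent; the error stays in `centralG`, and
  -- closedness of `G` permits the limit.
  have key : ∀ n, ∀ w : centralN r, ∃ g ∈ centralG r,
      (w : W) = g * (partialProd 1 r (fun i => c (ν^[i] w)) n * diag^[n] (ν^[n] w : W)) := by
    intro n
    induction n with
    | zero => exact fun w => ⟨1, one_mem _, by simp [partialProd_zero]⟩
    | succ n ih =>
      intro w
      obtain ⟨g, hg, e⟩ := ih (ν w)
      refine ⟨_, mul_mem (hγ w) (conj_mem_centralG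
        (pow_mem (wElt_zero_mem_centralN hr) (c w).val) (diag_mem_centralG hr hg)), ?_⟩
      rw [partialProd_succ', Function.iterate_succ_apply', Function.iterate_succ_apply]
      simp only [Function.iterate_succ_apply, Function.iterate_zero_apply]
      conv_lhs => rw [h w, e, map_mul, map_mul]
      group
  choose g hg e using key
  set w' : centralN r := ⟨w, hw⟩
  set k : ℕ → ZMod 2 := fun i => c (ν^[i] w')
  refine ⟨k, ?_⟩
  have ht : Tendsto (fun n => partialProd 1 r k n * diag^[n] (ν^[n] w' : W)) atTop
      (𝓝 (infProd r k)) :=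
    tendsto_of_eventually_eq fun t => (eventually_ge_atTop t.length).mono fun n hn => by
      rw [RelIso.mul_apply, diag_iterate_apply _ n t hn, partialProd_apply k n t hn]
  refine (isClosed_G 1 r).mem_of_tendsto (ht.inv.const_mul w) (Eventually.of_forall fun n => ?_)
  have := e n w'
  change w = _ at this
  rw [mul_inv_eq_iff_eq_mul.2 this]
  exact (hg n w').1

theorem exists_infProd (hr : 3 ≤ r) {w : W} (hw : w ∈ N 1 r) :
    ∃ k, w * (infProd r k)⁻¹ ∈ G 1 r := by
  have hl := lift_mem_G hr (octic (r - 2) w)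
  obtain ⟨k, hk⟩ := exists_infProd_of_mem_centralN hr (w := (lift r (octic (r - 2) w))⁻¹ * w)
    (Subgroup.mem_inf.2 ⟨mul_mem (inv_mem (G_le_N 1 r hl)) hw, by
      rw [Subgroup.mem_comap, map_mul, map_inv, octic_lift hr, inv_mul_cancel]
      exact one_mem _⟩)
  refine ⟨k, ?_⟩
  have := mul_mem hl hk
  rwa [mul_assoc, mul_inv_cancel_left] at this

/-- The infinite product as an element of `N`. -/
noncomputable def infProdN (hr : 3 ≤ r) (k : ℕ → ZMod 2) : N 1 r :=
  ⟨infProd r k, (infProd_mem_centralN hr k).1⟩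

theorem continuous_infProdN (hr : 3 ≤ r) : Continuous (infProdN hr) :=
  continuous_infProd.subtype_mk _

theorem mk_eq_mk_iff {a b : N 1 r} :
    (a : N 1 r ⧸ GinN 1 r) = b ↔ (a : W) * (b : W)⁻¹ ∈ G 1 r := by
  rw [QuotientGroup.eq_iff_div_mem, div_eq_mul_inv]
  exact Subgroup.mem_subgroupOf

/-- The homomorphism from sequences to `N / G` given by the infinite product. -/
noncomputable def infProdHom (hr : 3 ≤ r) :
    Multiplicative (ℕ → ZMod 2) →* N 1 r ⧸ GinN 1 r :=
  MonoidHom.mk' (fun k => (infProdN hr k.toAdd : N 1 r ⧸ GinN 1 r)) fun k l => by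
    rw [← QuotientGroup.mk_mul, eq_comm, mk_eq_mk_iff]
    exact infProd_add hr k.toAdd l.toAdd

theorem infProdHom_bijective (hr : 3 ≤ r) : Function.Bijective (infProdHom hr) := by
  refine ⟨(injective_iff_map_eq_one _).2 fun k hk => ?_, fun x => ?_⟩
  · change (infProdN hr k.toAdd : N 1 r ⧸ GinN 1 r) = ((1 : N 1 r) : N 1 r ⧸ GinN 1 r) at hk
    rw [mk_eq_mk_iff] at hk
    have : infProd r k.toAdd ∈ G 1 r := by simpa [infProdN] using hk
    exact eq_zero_of_infProd_mem_G hr this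
  · obtain ⟨w, rfl⟩ := QuotientGroup.mk_surjective x
    obtain ⟨k, hk⟩ := exists_infProd hr w.2
    exact ⟨Multiplicative.ofAdd k, (mk_eq_mk_iff.2 hk).symm⟩

theorem continuous_infProdHom (hr : 3 ≤ r) : Continuous (infProdHom hr) :=
  continuous_quotient_mk'.comp ((continuous_infProdN hr).comp continuous_toAdd)

theorem isClosed_GinN : IsClosed (GinN 1 r : Set (N 1 r)) :=
  (isClosed_G 1 r).preimage continuous_subtype_val

/-- The isomorphism of topological groups between sequences and `N / G`. -/
noncomputable def infProdEquiv (hr : 3 ≤ r) :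
    Multiplicative (ℕ → ZMod 2) ≃ₜ* (N 1 r ⧸ GinN 1 r) :=
  -- Closedness makes the quotient Hausdorff, so the continuous bijection from a compact space is a
  -- homeomorphism.
  haveI : IsClosed (GinN 1 r : Set (N 1 r)) := isClosed_GinN
  { MulEquiv.ofBijective (infProdHom hr) (infProdHom_bijective hr) with
    continuous_toFun := continuous_infProdHom hr
    continuous_invFun := Continuous.continuous_symm_of_equiv_compact_to_t2
      (f := (MulEquiv.ofBijective (infProdHom hr) (infProdHom_bijective hr)).toEquiv)
      (continuous_infProdHom hr) }

end

end BinaryTree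

theorem mainTheorem5 (s r : ℕ) (hs : s = 1) (hr : 3 ≤ r) :
    ∃ φ : (ℕ → ZMod 2) → BinaryTree.N s r,
      Continuous φ ∧
      (∀ k : ℕ → ZMod 2,
        Tendsto (BinaryTree.partialProd s r k) atTop (𝓝 (φ k : BinaryTree.W))) ∧
      ∃ φbar : Multiplicative (ℕ → ZMod 2) ≃ₜ* (BinaryTree.N s r ⧸ BinaryTree.GinN s r),
        ∀ k : ℕ → ZMod 2,
          φbar (Multiplicative.ofAdd k) = (φ k : BinaryTree.N s r ⧸ BinaryTree.GinN s r) := by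
  subst hs
  exact ⟨BinaryTree.infProdN hr, BinaryTree.continuous_infProdN hr,
    fun k => BinaryTree.tendsto_partialProd k, BinaryTree.infProdEquiv hr, fun _ => rfl⟩
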